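/- **Setup.** For $d\ge 1$ put $\omega=e^{2\pi i/d}$, $\tau=-e^{\pi i/d}$, and on $\mathbb C^d$ with basis $\{|k\rangle\}_{k\in\mathbb Z_d}$ let $Z|k\rangle=\omega^k|k\rangle$, $X|k\rangle=|k+1\rangle$. For $a=(a_1,a_2)$ with $a_1,a_2\in\{0,\dots,d-1\}$ let $D_a=\tau^{a_1a_2}X^{a_1}Z^{a_2}$, and for $\mathbf a=(\mathbf a_1,\dots,\mathbf a_n)\in\mathbb Z_d^{2n}$ let $D_{\mathbf a}=D_{\mathbf a_1}\otimes\cdots\otimes D_{\mathbf a_n}$ on $(\mathbb C^d)^{\otimes n}$. Let $[\mathbf a,\mathbf b]=\sum_i(a_{i,2}b_{i,1}-a_{i,1}b_{i,2})\in\mathbb Z_d$. The linear stabilizer entropy of a unit vector $\psi\in(\mathbb C^d)^{\otimes n}$ is $$M(\psi)=1-\frac1{d^n}\sum_{\mathbf a\in\mathbb Z_d^{2n}}\bigl|\mathrm{Tr}(D_{\mathbf a}^\dagger|\psi\rangle\langle\psi|)\bigr|^4 .$$ For a linear isometry $\mathcal E:(\mathbb C^{D})^{\otimes m}\to(\mathbb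 C^d)^{\otimes n}$ the average stabilizer entropy gap is $\Delta M(\mathcal E)=\mathbb E_\psi\,[M_B(\mathcal E\psi)-M_S(\psi)]$, where $M_B$ is the entropy on $n$ qudits of local dimension $d$, $M_S$ the one on $m$ qudits of local dimension $D$, and $\psi$ is a Haar-random (uniformly distributed) unit vector of $(\mathbb C^{D})^{\otimes m}$. **Theorem.** Let $\mathcal S\subseteq\mathbb Z_d^{2n}$ be a totally isotropic subgroup ($[\mathbf a,\mathbf b]=0$ for all $\mathbf a,\mathbf b\in\mathcal S$) whose stabilizer codespace for the trivial homomorphism, $\mathcal C_{\mathcal S}=\{v: D_{\mathbf a}v=v\ \ \forall \mathbf a\in\mathcal S\}$, is nonzero (this is automatic for odd $d$). Let $d_B=d^n$, let $D\ge1$ and $m\ge0$ be such that $d_S:=\dim\mathcal C_{\mathcal S}=D^m$, and let $\mathcal E_{\mathcal S}:(\mathbb C^D)^{\otimes m}\to(\mathbb C^d)^{\otimes n}$ be a linear isometry with range $\mathcal C_{\mathcal S}$. Then $d_S|\mathcal S|=d_B$ and $$\Delta M(\mathcal E_{\mathcal S})=\frac{\alpha\, d_B-|A_{\mathcal S}|\,d_S}{d_B(d_S+1)(d_S+2)(d_S+3)},$$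 where $$A_{\mathcal S}=\{\mathbf a\in\mathbb Z_d^{2n}: 2\mathbf a\in\mathcal S\text{ and }[\mathbf a,\mathbf b]=0\ \ \forall\mathbf b\in\mathcal S\},$$ and $\alpha=1$ if $d_S$ is odd; $\alpha=4$ if $d_S$ is even and the small space is a single qudit ($m=1$, $D=d_S$); $\alpha=d_S^2$ if the small space is $m$ qubits ($D=2$, $d_S=2^m$); and, in general, $\alpha=4^m$ if the small space is $m$ qudits of even local dimension $D$. -/

import Mathlib

open MeasureTheory
open scoped Matrix

noncomputable section

/-- The phase space `(ℤ_d × ℤ_d)^n` of symplectic indices of `n` qudits of local dimension `d`. -/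
abbrev PhaseSpace (d n : ℕ) : Type := Fin n → ZMod d × ZMod d

/-- The Hilbert space of `n` qudits, `(ℂ^d)^{⊗ n}`, with the computational basis labelled by
`(ℤ_d)^n`. -/
abbrev QuditSpace (d n : ℕ) : Type := EuclideanSpace ℂ (Fin n → ZMod d)

/-- `ω = exp (2 π i / d)`. -/
def omegaPhase (d : ℕ) : ℂ := Complex.exp (2 * Real.pi * Complex.I / d)

/-- `τ = - exp (π i / d)`. -/
def tauPhase (d : ℕ) : ℂ := -Complex.exp (Real.pi * Complex.I / d)

/-- The clock operator, `Z |k⟩ = ω^k |k⟩`. -/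
def clockMatrix (d : ℕ) : Matrix (ZMod d) (ZMod d) ℂ :=
  Matrix.diagonal fun k => omegaPhase d ^ k.val

/-- The shift operator, `X |k⟩ = |k + 1⟩`. -/
def shiftMatrix (d : ℕ) : Matrix (ZMod d) (ZMod d) ℂ :=
  Matrix.of fun j k => if j = k + 1 then 1 else 0

/-- The displacement operator `τ^{a₁ a₂} X^{a₁} Z^{a₂}` of one qudit, where `a₁, a₂` are represented
by integers in `{0, …, d - 1}`. -/
def displacementOne (d : ℕ) [NeZero d] (a : ZMod d × ZMod d) : Matrix (ZMod d) (ZMod d) ℂ :=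
  tauPhase d ^ (a.1.val * a.2.val) • (shiftMatrix d ^ a.1.val * clockMatrix d ^ a.2.val)

/-- The displacement operator `D_a = D_{a_1} ⊗ ⋯ ⊗ D_{a_n}` of `n` qudits. -/
def displacement {d n : ℕ} [NeZero d] (a : PhaseSpace d n) :
    Matrix (Fin n → ZMod d) (Fin n → ZMod d) ℂ :=
  Matrix.of fun x y => ∏ i, displacementOne d (a i) (x i) (y i)

/-- The symplectic form `[a, b] = ∑ i, (a_{i,2} b_{i,1} - a_{i,1} b_{i,2})` with values in `ℤ_d`. -/
def symplecticForm {d n : ℕ} (a b : PhaseSpace d n) : ZMod d :=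
  ∑ i, ((a i).2 * (b i).1 - (a i).1 * (b i).2)

/-- A subgroup of phase space is totally isotropic if the symplectic form vanishes on it. -/
def IsTotallyIsotropic {d n : ℕ} (S : AddSubgroup (PhaseSpace d n)) : Prop :=
  ∀ a ∈ S, ∀ b ∈ S, symplecticForm a b = 0

/-- The stabilizer codespace of `S` and a homomorphism `f : S → ℤ_d`: the common `+1` eigenspace of
the operators `ω^{f(a)} D_a`, `a ∈ S`. -/
def stabilizerCodespace {d n : ℕ} [NeZero d] (S : AddSubgroup (PhaseSpace d n))
    (f : S →+ ZMod d) : Submodule ℂ (QuditSpace d n) :=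
  ⨅ a : S, LinearMap.ker
    (Matrix.toEuclideanLin (omegaPhase d ^ (f a).val • displacement (a : PhaseSpace d n)) - 1)

/-- The symplectic complement `S^⊥`. -/
def symplecticPerp {d n : ℕ} (S : AddSubgroup (PhaseSpace d n)) : Set (PhaseSpace d n) :=
  {a | ∀ b ∈ S, symplecticForm a b = 0}

/-- The set `A_S` of all `a` with `2 a ∈ S` and `a ∈ S^⊥`. -/
def halfPerpSet {d n : ℕ} (S : AddSubgroup (PhaseSpace d n)) : Set (PhaseSpace d n) :=
  {a | 2 • a ∈ S ∧ a ∈ symplecticPerp S}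

/-- The density operator `|ψ⟩⟨ψ|`. -/
def pureState {d n : ℕ} (ψ : QuditSpace d n) :
    Matrix (Fin n → ZMod d) (Fin n → ZMod d) ℂ :=
  Matrix.vecMulVec (fun x => ψ x) (fun x => star (ψ x))

/-- The linear stabilizer entropy `M(ψ) = 1 - d^{-n} ∑_a |Tr (D_a† |ψ⟩⟨ψ|)|⁴` of the pure state
given by a unit vector `ψ`. -/
def stabilizerEntropy {d n : ℕ} [NeZero d] (ψ : QuditSpace d n) : ℝ :=
  1 - 1 / (d : ℝ) ^ n *
    ∑ a : PhaseSpace d n, ‖((displacement a)ᴴ * pureState ψ).trace‖ ^ 4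

/-- The average stabilizer entropy gap of an isometric embedding `V` of `m` qudits of local
dimension `D` into `n` qudits of local dimension `d`: the average of `M_B(V ψ) - M_S(ψ)` over the
uniform (unitarily invariant) probability distribution on the unit vectors `ψ` of the small space. -/
def aseGap {D m d n : ℕ} [NeZero D] [NeZero d] (V : QuditSpace D m →ₗᵢ[ℂ] QuditSpace d n) : ℝ :=
  ⨍ ψ : Metric.sphere (0 : QuditSpace D m) 1,
    (stabilizerEntropy (V ψ) - stabilizerEntropy (ψ : QuditSpace D m))
      ∂(volume : Measure (QuditSpace D m)).toSphere

end

/-! Write N = d_S. The average is taken one displacement at a time: the mean of |⟨Vψ, D_b Vψ⟩|⁴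
depends only on the position of b relative to the chain S ⊆ A_S ⊆ S^⊥. It is 1 on S. It is 0 off
S^⊥, since D_b then fails to commute with some stabilizer. For b in S^⊥ but not in S, the
compression U = V†D_bV is a traceless unitary, and its fourth moment
(`average_sphere_unitary_pow_four`) depends on b only through |tr U²|², which is N² if 2b ∈ S and 0
otherwise. The mean is thus a combination of three indicator functions
(`average_sphere_weylOperator_pow_four`), and summing over b needs only |S| = d_B/N, |S^⊥| = N d_B
and |A_S|. After division by d_B the first two contributions depend on N alone. The small space is
itself the code of the trivial subgroup, with the same N, so these cancel in the gap; what remains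
compares |A_S|/d_B with α/N, where α counts the points a of the small phase space with 2a = 0.

For the moments, polar coordinates turn a sphere average into a Gaussian integral: a Hermitian form
with eigenvalues c has k-th moment h_k(c)/h_k(1,…,1), with h_k complete homogeneous, and power sums
turn this into traces. A unitary U is reached through the Hermitian operators w^j U + w^(-j) U†,
with w a primitive cube root of unity. -/

/-! ### Complete homogeneous sums and power sums. -/

/-- The complete homogeneous symmetric sum of degree `k` in the values `c i`, `i ∈ s`. -/
def completeHomogSum {ι R : Type*} [DecidableEq ι] [CommRing R] (c : ι → R) (s : Finset ι)
    (k : ℕ) : R :=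
  ∑ f ∈ s.piAntidiag k, ∏ i ∈ s, c i ^ f i

lemma completeHomogSum_cons {ι R : Type*} [DecidableEq ι] [CommRing R] (c : ι → R) {s : Finset ι}
    {j : ι} (hj : j ∉ s) (k : ℕ) :
    completeHomogSum c (s.cons j hj) k =
      ∑ p ∈ Finset.HasAntidiagonal.antidiagonal k, c j ^ p.1 * completeHomogSum c s p.2 := by
  rw [completeHomogSum, Finset.piAntidiag_cons hj, Finset.sum_disjiUnion]
  refine Finset.sum_congr rfl fun p _ => ?_
  rw [Finset.sum_map, completeHomogSum, Finset.mul_sum]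
  refine Finset.sum_congr rfl fun f hf => ?_
  have hfj : f j = 0 := by
    by_contra h
    exact hj ((Finset.mem_piAntidiag.1 hf).2 j h)
  rw [Finset.prod_cons]
  congr 1
  · simp [hfj]
  · refine Finset.prod_congr rfl fun i hi => ?_
    have : i ≠ j := fun h => hj (h ▸ hi)
    simp [this]

/-- Adjoining j replaces h_k by the sum of c_j^a h_(k-a), so induction on s closes each identity
from those of lower degree. The factor k! clears denominators. -/
lemma completeHomogSum_eq_powerSums {ι R : Type*} [DecidableEq ι] [CommRing R] (c : ι → R)
    (s : Finset ι) :
    completeHomogSum c s 0 = 1 ∧ completeHomogSum c s 1 = ∑ i ∈ s, c i ∧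
    2 * completeHomogSum c s 2 = (∑ i ∈ s, c i) ^ 2 + ∑ i ∈ s, c i ^ 2 ∧
    6 * completeHomogSum c s 3 = (∑ i ∈ s, c i) ^ 3 + 3 * (∑ i ∈ s, c i) * ∑ i ∈ s, c i ^ 2
      + 2 * ∑ i ∈ s, c i ^ 3 ∧
    24 * completeHomogSum c s 4 = (∑ i ∈ s, c i) ^ 4 + 6 * (∑ i ∈ s, c i) ^ 2 * ∑ i ∈ s, c i ^ 2
      + 3 * (∑ i ∈ s, c i ^ 2) ^ 2 + 8 * (∑ i ∈ s, c i) * ∑ i ∈ s, c i ^ 3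
      + 6 * ∑ i ∈ s, c i ^ 4 := by
  induction s using Finset.cons_induction with
  | empty => simp [completeHomogSum]
  | cons j s hj ih =>
    obtain ⟨h0, h1, h2, h3, h4⟩ := ih
    simp only [completeHomogSum_cons, Finset.Nat.antidiagonal_succ, Finset.sum_cons,
      Finset.Nat.antidiagonal_zero, Finset.map_cons, Finset.map_singleton,
      Finset.sum_singleton, Function.Embedding.coeFn_mk, Function.Embedding.prodMap,
      Function.Embedding.refl_apply, Prod.map, Nat.succ_eq_add_one, zero_add, h0, h1]
    refine ⟨by simp, by ring, ?_, ?_, ?_⟩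
    · linear_combination h2
    · linear_combination h3 + 3 * c j * h2
    · linear_combination h4 + 4 * c j * h3 + 12 * c j ^ 2 * h2

/-! ### Gaussian moments and averages over the sphere. -/

lemma Complex.integral_norm_sq_pow_mul_exp_neg (k : ℕ) :
    ∫ z : ℂ, (‖z‖ ^ 2) ^ k * Real.exp (-‖z‖ ^ 2) = Real.pi * k.factorial := by
  have h := Complex.integral_rpow_mul_exp_neg_rpow (p := 2) (q := 2 * k) (by norm_num)
    (by have : (0 : ℝ) ≤ k := k.cast_nonneg
        linarith)
  have e : ((2 : ℝ) * k + 2) / 2 = k + 1 := by ring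
  rw [e, Real.Gamma_nat_eq_factorial] at h
  rw [← mul_div_cancel_left₀ Real.pi (two_ne_zero (α := ℝ)), ← h]
  refine integral_congr_ae (.of_forall fun z => ?_)
  simp only
  rw [← pow_mul, ← Real.rpow_natCast ‖z‖ (2 * k), ← Real.rpow_natCast ‖z‖ 2]
  push_cast
  rfl

lemma Complex.integrable_norm_sq_pow_mul_exp_neg (k : ℕ) :
    Integrable fun z : ℂ => (‖z‖ ^ 2) ^ k * Real.exp (-‖z‖ ^ 2) := by
  -- A non-integrable function has integral 0 by convention, whereas the computed value is positive.
  refine not_imp_comm.1 integral_undef ?_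
  rw [Complex.integral_norm_sq_pow_mul_exp_neg]
  positivity

/-- Gaussian moments of a diagonal Hermitian form. -/
lemma integral_diagonalForm_pow_mul_gaussian {ι : Type*} [Fintype ι] [DecidableEq ι] (c : ι → ℝ)
    (k : ℕ) :
    ∫ z : ι → ℂ, (∑ i, c i * ‖z i‖ ^ 2) ^ k * Real.exp (-∑ i, ‖z i‖ ^ 2) =
      Real.pi ^ Fintype.card ι * (k.factorial * completeHomogSum c Finset.univ k) := by
  have hexp : ∀ z : ι → ℂ, (∑ i, c i * ‖z i‖ ^ 2) ^ k * Real.exp (-∑ i, ‖z i‖ ^ 2) =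
      ∑ f ∈ Finset.univ.piAntidiag k, (Nat.multinomial Finset.univ f * ∏ i, c i ^ f i) *
        ∏ i, ((‖z i‖ ^ 2) ^ f i * Real.exp (-‖z i‖ ^ 2)) := by
    intro z
    rw [Finset.sum_pow_eq_sum_piAntidiag, Finset.sum_mul]
    refine Finset.sum_congr rfl fun f _ => ?_
    rw [← Finset.sum_neg_distrib, Real.exp_sum, Finset.prod_mul_distrib]
    simp only [mul_pow, Finset.prod_mul_distrib]
    ring
  simp only [hexp]
  rw [integral_finsetSum]
  · rw [completeHomogSum, Finset.mul_sum, Finset.mul_sum]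
    refine Finset.sum_congr rfl fun f hf => ?_
    rw [integral_const_mul, integral_fintype_prod_volume_eq_prod
      (f := fun (i : ι) (z : ℂ) => (‖z‖ ^ 2) ^ f i * Real.exp (-‖z‖ ^ 2))]
    simp only [Complex.integral_norm_sq_pow_mul_exp_neg, Finset.prod_mul_distrib,
      Finset.prod_const, Finset.card_univ]
    have hm : ((∏ i, ((f i).factorial : ℝ)) * Nat.multinomial Finset.univ f) = k.factorial := by
      have := Nat.multinomial_spec Finset.univ f
      rw [(Finset.mem_piAntidiag.1 hf).1] at this
      exact_mod_cast this
    rw [← hm]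
    ring
  · intro f _
    refine Integrable.const_mul ?_ _
    exact Integrable.fintype_prod (f := fun (i : ι) (z : ℂ) =>
      (‖z‖ ^ 2) ^ f i * Real.exp (-‖z‖ ^ 2)) fun i =>
      Complex.integrable_norm_sq_pow_mul_exp_neg (f i)

/-- Integration in polar coordinates of a homogeneous function against a Gaussian weight. -/
lemma integral_homogeneous_mul_gaussian {E : Type*} [NormedAddCommGroup E] [NormedSpace ℝ E]
    [MeasurableSpace E] [BorelSpace E] [FiniteDimensional ℝ E] [Nontrivial E] (μ : Measure E)
    [μ.IsAddHaarMeasure] (p : ℕ) (f : E → ℝ) (hf : ∀ (r : ℝ) (x : E), f (r • x) = r ^ p * f x) :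
    ∫ x, f x * Real.exp (-‖x‖ ^ 2) ∂μ = (∫ x : Metric.sphere (0 : E) 1, f x ∂μ.toSphere) *
      ∫ r : Set.Ioi (0 : ℝ), (r : ℝ) ^ p * Real.exp (-(r : ℝ) ^ 2)
        ∂(Measure.volumeIoiPow (Module.finrank ℝ E - 1)) := by
  calc
    ∫ x, f x * Real.exp (-‖x‖ ^ 2) ∂μ
        = ∫ x : ({(0)}ᶜ : Set E), f x.1 * Real.exp (-‖x.1‖ ^ 2) ∂(μ.comap (↑)) := by
      rw [integral_subtype_comap (measurableSet_singleton _).compl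
        fun x ↦ f x * Real.exp (-‖x‖ ^ 2), restrict_compl_singleton]
    _ = ∫ x : Metric.sphere (0 : E) 1 × Set.Ioi (0 : ℝ),
          f x.1 * ((x.2 : ℝ) ^ p * Real.exp (-(x.2 : ℝ) ^ 2))
          ∂μ.toSphere.prod (.volumeIoiPow (Module.finrank ℝ E - 1)) := by
      rw [← μ.measurePreserving_homeomorphUnitSphereProd.integral_comp
        (Homeomorph.measurableEmbedding _)]
      refine integral_congr_ae (.of_forall fun x => ?_)
      have hx : ‖(x : E)‖ ≠ 0 := norm_ne_zero_iff.2 x.2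
      simp only [homeomorphUnitSphereProd_apply_snd_coe, homeomorphUnitSphereProd_apply_fst_coe,
        hf]
      rw [inv_pow]
      field_simp
    _ = _ := integral_prod_mul (fun x : Metric.sphere (0 : E) 1 => f x)
        (fun r : Set.Ioi (0 : ℝ) => (r : ℝ) ^ p * Real.exp (-(r : ℝ) ^ 2))

/-- The average over the unit sphere of a power of a Hermitian form that is diagonal in an
orthonormal basis. -/
lemma average_sphere_diagonalForm_pow {E ι : Type*} [NormedAddCommGroup E]
    [InnerProductSpace ℂ E] [NormedSpace ℝ E] [IsScalarTower ℝ ℂ E] [MeasurableSpace E]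
    [BorelSpace E] [FiniteDimensional ℝ E] [Nontrivial E] (μ : Measure E) [μ.IsAddHaarMeasure]
    [Fintype ι] [DecidableEq ι] (b : OrthonormalBasis ι ℂ E) (c : ι → ℝ) (k : ℕ) :
    ⨍ ψ : Metric.sphere (0 : E) 1, (∑ i, c i * ‖b.repr (ψ : E) i‖ ^ 2) ^ k ∂μ.toSphere =
      completeHomogSum c Finset.univ k / completeHomogSum (fun _ : ι => (1 : ℝ)) Finset.univ k := by
  let L : E ≃L[ℝ] (ι → ℂ) := ((b.repr.toLinearEquiv.trans
    (EuclideanSpace.equiv ι ℂ).toLinearEquiv).restrictScalars ℝ).toContinuousLinearEquiv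
  have hL : ∀ x i, L x i = b.repr x i := fun x i => rfl
  have hnorm : ∀ x : E, ‖x‖ ^ 2 = ∑ i, ‖L x i‖ ^ 2 := fun x => by
    rw [← b.repr.norm_map, EuclideanSpace.norm_sq_eq]
    rfl
  have := L.isAddHaarMeasure_map μ
  set κ := Measure.addHaarScalarFactor (μ.map L) (volume : Measure (ι → ℂ)) with hκ
  have hmap : μ.map L = κ • volume := Measure.isAddLeftInvariant_eq_smul _ _
  set K := ∫ r : Set.Ioi (0 : ℝ), (r : ℝ) ^ (2 * k) * Real.exp (-(r : ℝ) ^ 2)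
        ∂(Measure.volumeIoiPow (Module.finrank ℝ E - 1)) with hK
  have key : ∀ c : ι → ℝ, (∫ ψ : Metric.sphere (0 : E) 1,
      (∑ i, c i * ‖b.repr (ψ : E) i‖ ^ 2) ^ k ∂μ.toSphere) * K =
      κ * Real.pi ^ Fintype.card ι * k.factorial * completeHomogSum c Finset.univ k := by
    intro c
    rw [hK, ← integral_homogeneous_mul_gaussian μ (2 * k)
      (fun x => (∑ i, c i * ‖b.repr x i‖ ^ 2) ^ k)]
    · have h1 := L.toHomeomorph.measurableEmbedding.integral_map (μ := μ)
        (fun z : ι → ℂ => (∑ i, c i * ‖z i‖ ^ 2) ^ k * Real.exp (-∑ i, ‖z i‖ ^ 2))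
      change ∫ y, _ ∂(μ.map L) = _ at h1
      rw [hmap, integral_smul_nnreal_measure, integral_diagonalForm_pow_mul_gaussian] at h1
      simp only [hnorm]
      refine h1.symm.trans ?_
      rw [NNReal.smul_def, smul_eq_mul]
      ring
    · intro r x
      have : ∀ i, b.repr (r • x) i = r • b.repr x i := fun i => by
        rw [← hL, ← hL, map_smul, Pi.smul_apply]
      simp only [this, norm_smul, mul_pow, Real.norm_eq_abs, sq_abs]
      rw [pow_mul, ← mul_pow, Finset.mul_sum]
      congr 1
      exact Finset.sum_congr rfl fun i _ => by ring
  -- The form with c = 1 is constantly 1 on the sphere, so this case calibrates the total mass. It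
  -- also shows that the radial factor `K` is nonzero, and dividing by it removes `K`, the Haar
  -- factor, π and k!.
  have h1 := key fun _ => 1
  have hκ0 : (κ : ℝ) ≠ 0 := by
    intro h
    have h' : κ = 0 := by exact_mod_cast h
    rw [h', zero_smul] at hmap
    exact (NeZero.ne (μ.map L)) hmap
  have hone : (∫ ψ : Metric.sphere (0 : E) 1,
      (∑ i, 1 * ‖b.repr (ψ : E) i‖ ^ 2) ^ k ∂μ.toSphere) = μ.toSphere.real Set.univ := by
    have : ∀ ψ : Metric.sphere (0 : E) 1, (∑ i, 1 * ‖b.repr (ψ : E) i‖ ^ 2) ^ k = 1 := by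
      intro ψ
      have h := hnorm ψ
      simp only [hL, norm_eq_of_mem_sphere, one_pow] at h
      simp [← h]
    simp only [this, integral_const, smul_eq_mul, mul_one]
  have hpos : 0 < completeHomogSum (fun _ : ι => (1 : ℝ)) Finset.univ k := by
    have : Nonempty ι := b.toBasis.index_nonempty
    simp only [completeHomogSum, one_pow, Finset.prod_const_one, Finset.sum_const, nsmul_eq_mul,
      mul_one, Nat.cast_pos, Finset.card_pos]
    obtain ⟨i⟩ := this
    exact ⟨Pi.single i k, by
      simp [Finset.mem_piAntidiag]⟩
  rw [hone] at h1
  have hne : μ.toSphere.real Set.univ * K ≠ 0 := by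
    rw [h1]
    positivity
  have hs := left_ne_zero_of_mul hne
  rw [average_eq, smul_eq_mul, eq_div_iff hpos.ne']
  refine mul_left_cancel₀ hne ?_
  rw [← mul_assoc, mul_mul_mul_comm, mul_inv_cancel₀ hs]
  linear_combination completeHomogSum (fun _ : ι => (1 : ℝ)) Finset.univ k * key c -
    completeHomogSum c Finset.univ k * h1

/-! ### Traces and eigenvalues. -/

lemma LinearMap.trace_adjoint_eq_conj {E : Type*} [NormedAddCommGroup E] [InnerProductSpace ℂ E]
    [FiniteDimensional ℂ E] (T : E →ₗ[ℂ] E) :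
    LinearMap.trace ℂ E T.adjoint = (starRingEnd ℂ) (LinearMap.trace ℂ E T) := by
  rw [LinearMap.trace_eq_sum_inner _ (stdOrthonormalBasis ℂ E),
    LinearMap.trace_eq_sum_inner _ (stdOrthonormalBasis ℂ E), map_sum]
  refine Finset.sum_congr rfl fun i _ => ?_
  rw [LinearMap.adjoint_inner_right, inner_conj_symm]

lemma LinearMap.IsSymmetric.trace_pow_eq_sum_eigenvalues {E : Type*} [NormedAddCommGroup E]
    [InnerProductSpace ℂ E] [FiniteDimensional ℂ E] {T : E →ₗ[ℂ] E} (hT : T.IsSymmetric) (k : ℕ) :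
    LinearMap.trace ℂ E (T ^ k) = ((∑ i, hT.eigenvalues rfl i ^ k : ℝ) : ℂ) := by
  have h : ∀ i, (T ^ k) (hT.eigenvectorBasis rfl i) =
      ((hT.eigenvalues rfl i : ℂ) ^ k) • hT.eigenvectorBasis rfl i := by
    intro i
    induction k with
    | zero => simp
    | succ k ih =>
      rw [pow_succ', Module.End.mul_apply, ih, map_smul, hT.apply_eigenvectorBasis, smul_smul,
        pow_succ]
      rfl
  rw [LinearMap.trace_eq_sum_inner _ (hT.eigenvectorBasis rfl)]
  push_cast
  refine Finset.sum_congr rfl fun i _ => ?_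
  rw [h, inner_smul_right, inner_self_eq_norm_sq_to_K, OrthonormalBasis.norm_eq_one]
  simp

lemma LinearMap.IsSymmetric.inner_self_eq_sum_eigenvalues {E : Type*} [NormedAddCommGroup E]
    [InnerProductSpace ℂ E] [FiniteDimensional ℂ E] {T : E →ₗ[ℂ] E} (hT : T.IsSymmetric) (x : E) :
    inner ℂ x (T x) =
      ((∑ i, hT.eigenvalues rfl i * ‖(hT.eigenvectorBasis rfl).repr x i‖ ^ 2 : ℝ) : ℂ) := by
  rw [← (hT.eigenvectorBasis rfl).sum_inner_mul_inner]
  push_cast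
  refine Finset.sum_congr rfl fun i _ => ?_
  rw [← hT, hT.apply_eigenvectorBasis, inner_smul_left, OrthonormalBasis.repr_apply_apply,
    ← Complex.mul_conj', inner_conj_symm]
  simp only [Complex.coe_algebraMap, Complex.conj_ofReal]
  ring

/-! ### Fourth moments of Hermitian and unitary operators. -/

section SphereAverage

variable {E : Type*} [NormedAddCommGroup E] [InnerProductSpace ℂ E] [NormedSpace ℝ E]
  [IsScalarTower ℝ ℂ E] [MeasurableSpace E] [BorelSpace E] [FiniteDimensional ℝ E]
  [FiniteDimensional ℂ E] [Nontrivial E] (μ : Measure E) [μ.IsAddHaarMeasure]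

/-- The fourth moment of the expectation value of a traceless Hermitian operator in a uniformly
distributed unit vector. -/
lemma average_sphere_symmetric_pow_four {T : E →ₗ[ℂ] E} (hT : T.IsSymmetric)
    (htr : LinearMap.trace ℂ E T = 0) :
    ((⨍ ψ : Metric.sphere (0 : E) 1, (inner ℂ (ψ : E) (T ψ)).re ^ 4 ∂μ.toSphere : ℝ) : ℂ) =
      (3 * LinearMap.trace ℂ E (T ^ 2) ^ 2 + 6 * LinearMap.trace ℂ E (T ^ 4)) /
        (Module.finrank ℂ E * (Module.finrank ℂ E + 1) * (Module.finrank ℂ E + 2) *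
          (Module.finrank ℂ E + 3)) := by
  set N := Module.finrank ℂ E with hN
  have h1 : ∑ i, hT.eigenvalues rfl i = 0 := by
    have := hT.trace_pow_eq_sum_eigenvalues 1
    simp only [pow_one, htr] at this
    exact_mod_cast this.symm
  simp only [hT.inner_self_eq_sum_eigenvalues, Complex.ofReal_re,
    hT.trace_pow_eq_sum_eigenvalues]
  rw [average_sphere_diagonalForm_pow]
  obtain ⟨-, -, -, -, hc⟩ := completeHomogSum_eq_powerSums (hT.eigenvalues rfl) Finset.univ
  obtain ⟨-, -, -, -, ho⟩ := completeHomogSum_eq_powerSums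
    (fun _ : Fin (Module.finrank ℂ E) => (1 : ℝ)) Finset.univ
  -- With first power sum p₁ = 0, only 24 h₄ = 3 p₂² + 6 p₄ survives; at c = 1 the same formula
  -- gives N(N+1)(N+2)(N+3).
  rw [h1] at hc
  simp only [one_pow, Finset.sum_const, Finset.card_univ, Fintype.card_fin, nsmul_eq_mul, mul_one,
    ← hN] at ho
  rw [← mul_div_mul_left _ _ (by norm_num : (24 : ℝ) ≠ 0), hc, ho]
  push_cast
  congr 1 <;> ring

lemma exists_cubeRoot : ∃ w : ℂ, w ^ 2 + w + 1 = 0 ∧ (starRingEnd ℂ) w = w ^ 2 := by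
  have hp := Complex.isPrimitiveRoot_exp 3 (by norm_num)
  refine ⟨Complex.exp (2 * Real.pi * Complex.I / (3 : ℕ)), ?_, ?_⟩
  · have := hp.geom_sum_eq_zero (by norm_num)
    simp only [Finset.sum_range_succ, Finset.sum_range_zero] at this
    linear_combination this
  · rw [← Complex.inv_eq_conj (Complex.norm_eq_one_of_pow_eq_one hp.pow_eq_one (by norm_num))]
    refine inv_eq_of_mul_eq_one_right ?_
    rw [← pow_succ', hp.pow_eq_one]

/-- Summing over the three rotations kills monomials whose weight (±4 or ±2) is not divisible by 3,
and triples 6u²v². The cofactors are quotients by w² + w + 1, e.g. of w⁸ + w⁴ + 1. -/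
lemma sum_rotated_pow_four {w : ℂ} (hw : w ^ 2 + w + 1 = 0) (u v : ℂ) :
    (u + v) ^ 4 + (w * u + w ^ 2 * v) ^ 4 + (w ^ 2 * u + w * v) ^ 4 = 18 * (u * v) ^ 2 := by
  linear_combination ((u ^ 4 + v ^ 4) * ((w ^ 2 - w + 1) * (w ^ 4 - w ^ 2 + 1)) +
    4 * (u ^ 3 * v + u * v ^ 3) * (w ^ 5 - (w - 1) * (w ^ 3 + 1)) +
    12 * u ^ 2 * v ^ 2 * ((w - 1) * (w ^ 3 + 1))) * hw

/-- The fourth absolute moment of the expectation value of a traceless unitary operator in a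
uniformly distributed unit vector. -/
lemma average_sphere_unitary_pow_four {U : E →ₗ[ℂ] E} (hU : LinearMap.adjoint U * U = 1)
    (htr : LinearMap.trace ℂ E U = 0) :
    ⨍ ψ : Metric.sphere (0 : E) 1, ‖inner ℂ (ψ : E) (U ψ)‖ ^ 4 ∂μ.toSphere =
      (‖LinearMap.trace ℂ E (U ^ 2)‖ ^ 2 + 2 * (Module.finrank ℂ E : ℝ) ^ 2
          + 6 * Module.finrank ℂ E) /
        (Module.finrank ℂ E * (Module.finrank ℂ E + 1) * (Module.finrank ℂ E + 2) *
          (Module.finrank ℂ E + 3)) := by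
  set N := Module.finrank ℂ E with hN
  obtain ⟨w, hw, hwc⟩ := exists_cubeRoot
  have hw3 : w ^ 3 = 1 := by linear_combination (w - 1) * hw
  set U' := LinearMap.adjoint U with hU'
  have hU2 : U * U' = 1 := mul_eq_one_comm.1 hU
  have hpow : ∀ k, U' ^ k = LinearMap.adjoint (U ^ k) := fun k => (star_pow U k).symm
  have hsymm : ∀ a b : ℂ, (starRingEnd ℂ) a = b → (a • U + b • U').IsSymmetric := by
    intro a b hab x y
    have hba : (starRingEnd ℂ) b = a := by rw [← hab, Complex.conj_conj]
    simp only [LinearMap.add_apply, LinearMap.smul_apply, inner_add_left, inner_add_right,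
      inner_smul_left, inner_smul_right, hab, hba, hU', LinearMap.adjoint_inner_left,
      LinearMap.adjoint_inner_right]
    ring
  -- U and U† are inverse, so cross terms become scalars once ab = 1. The pairs (1, 1), (w, w²),
  -- (w², w) satisfy this and b = conj a.
  have hsq : ∀ a b : ℂ, a * b = 1 →
      (a • U + b • U') ^ 2 = a ^ 2 • U ^ 2 + (2 : ℂ) • 1 + b ^ 2 • U' ^ 2 := by
    intro a b hab
    have hba : b * a = 1 := by rw [mul_comm, hab]
    simp only [pow_two, add_mul, mul_add, smul_mul_smul_comm, hU, hU2, hab, hba]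
    module
  have hquart : ∀ a b : ℂ, a * b = 1 →
      (a • U + b • U') ^ 4 = a ^ 4 • U ^ 4 + (4 * a ^ 2) • U ^ 2 + (6 : ℂ) • 1
        + (4 * b ^ 2) • U' ^ 2 + b ^ 4 • U' ^ 4 := by
    intro a b hab
    have hab2 : a ^ 2 * b ^ 2 = 1 := by rw [← mul_pow, hab, one_pow]
    have hba2 : b ^ 2 * a ^ 2 = 1 := by rw [mul_comm, hab2]
    have h1 : U ^ 2 * U' ^ 2 = 1 := by
      rw [pow_two, pow_two, mul_assoc, ← mul_assoc U U' U', hU2, one_mul, hU2]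
    have h2 : U' ^ 2 * U ^ 2 = 1 := by
      rw [pow_two, pow_two, mul_assoc, ← mul_assoc U' U U, hU, one_mul, hU]
    have h3 : ∀ W : E →ₗ[ℂ] E, W ^ 4 = W ^ 2 * W ^ 2 := fun W => by rw [← pow_add]
    rw [h3, hsq a b hab, h3 U, h3 U']
    simp only [add_mul, mul_add, smul_mul_smul_comm, h1, h2, hab2, hba2, mul_one, one_mul]
    module
  set q := LinearMap.trace ℂ E (U ^ 2)
  set t := LinearMap.trace ℂ E (U ^ 4)
  have htrace : ∀ a b : ℂ, LinearMap.trace ℂ E (a • U + b • U') = 0 := by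
    intro a b
    rw [map_add, map_smul, map_smul, hU', LinearMap.trace_adjoint_eq_conj, htr]
    simp
  have hsqtr : ∀ a b : ℂ, a * b = 1 → LinearMap.trace ℂ E ((a • U + b • U') ^ 2) =
      a ^ 2 * q + 2 * N + b ^ 2 * (starRingEnd ℂ) q := by
    intro a b hab
    rw [hsq a b hab, hpow]
    simp only [map_add, map_smul, LinearMap.trace_adjoint_eq_conj, LinearMap.trace_one, smul_eq_mul,
      q, hN]
  have hquarttr : ∀ a b : ℂ, a * b = 1 → LinearMap.trace ℂ E ((a • U + b • U') ^ 4) =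
      a ^ 4 * t + 4 * a ^ 2 * q + 6 * N + 4 * b ^ 2 * (starRingEnd ℂ) q
        + b ^ 4 * (starRingEnd ℂ) t := by
    intro a b hab
    rw [hquart a b hab, hpow, hpow]
    simp only [map_add, map_smul, LinearMap.trace_adjoint_eq_conj, LinearMap.trace_one, smul_eq_mul,
      q, t, hN]
  have hs1 := hsymm 1 1 (map_one _)
  have hs2 := hsymm w (w ^ 2) hwc
  have hs3 := hsymm (w ^ 2) w (by rw [map_pow, hwc]; linear_combination w * hw3)
  have hp2 : w * w ^ 2 = 1 := by rw [← hw3]; ring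
  have hp3 : w ^ 2 * w = 1 := by rw [← hw3]; ring
  have hre : ∀ {T : E →ₗ[ℂ] E}, T.IsSymmetric → ∀ x : E,
      (((inner ℂ x (T x)).re : ℝ) : ℂ) = inner ℂ x (T x) := by
    intro T hT x
    rw [← Complex.conj_eq_iff_re, inner_conj_symm, hT]
  have hpt : ∀ ψ : Metric.sphere (0 : E) 1, ‖inner ℂ (ψ : E) (U ψ)‖ ^ 4 = 18⁻¹ *
      ((inner ℂ (ψ : E) (((1 : ℂ) • U + (1 : ℂ) • U') ψ)).re ^ 4 +
        (inner ℂ (ψ : E) ((w • U + w ^ 2 • U') ψ)).re ^ 4 +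
        (inner ℂ (ψ : E) ((w ^ 2 • U + w • U') ψ)).re ^ 4) := by
    intro ψ
    have hn : ((‖inner ℂ (ψ : E) (U ψ)‖ ^ 4 : ℝ) : ℂ) = (inner ℂ (ψ : E) (U ψ) *
        (starRingEnd ℂ) (inner ℂ (ψ : E) (U ψ))) ^ 2 := by
      rw [Complex.mul_conj']
      push_cast
      ring
    apply Complex.ofReal_injective
    rw [hn]
    push_cast
    rw [hre hs1, hre hs2, hre hs3]
    simp only [LinearMap.add_apply, LinearMap.smul_apply, inner_add_right, inner_smul_right, hU',
      LinearMap.adjoint_inner_right, ← inner_conj_symm (U (ψ : E)) (ψ : E), one_mul]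
    linear_combination -(18⁻¹ : ℂ) * sum_rotated_pow_four hw (inner ℂ (ψ : E) (U ψ))
      ((starRingEnd ℂ) (inner ℂ (ψ : E) (U ψ)))
  have hint : ∀ T : E →ₗ[ℂ] E, Integrable
      (fun ψ : Metric.sphere (0 : E) 1 => (inner ℂ (ψ : E) (T ψ)).re ^ 4) μ.toSphere := by
    intro T
    have hTc : Continuous T := T.continuous_of_finiteDimensional
    refine Continuous.integrable_of_hasCompactSupport (by fun_prop) ?_
    exact HasCompactSupport.of_compactSpace _
  have e1 := average_sphere_symmetric_pow_four μ hs1 (htrace _ _)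
  have e2 := average_sphere_symmetric_pow_four μ hs2 (htrace _ _)
  have e3 := average_sphere_symmetric_pow_four μ hs3 (htrace _ _)
  rw [hsqtr _ _ (one_mul _), hquarttr _ _ (one_mul _)] at e1
  rw [hsqtr _ _ hp2, hquarttr _ _ hp2] at e2
  rw [hsqtr _ _ hp3, hquarttr _ _ hp3] at e3
  have hq : ((‖q‖ ^ 2 : ℝ) : ℂ) = q * (starRingEnd ℂ) q := by
    rw [Complex.mul_conj']
    push_cast
    ring
  have hsum : ⨍ ψ : Metric.sphere (0 : E) 1, ‖inner ℂ (ψ : E) (U ψ)‖ ^ 4 ∂μ.toSphere = 18⁻¹ *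
      ((⨍ ψ : Metric.sphere (0 : E) 1,
        (inner ℂ (ψ : E) (((1 : ℂ) • U + (1 : ℂ) • U') ψ)).re ^ 4 ∂μ.toSphere) +
       (⨍ ψ : Metric.sphere (0 : E) 1,
        (inner ℂ (ψ : E) ((w • U + w ^ 2 • U') ψ)).re ^ 4 ∂μ.toSphere) +
       (⨍ ψ : Metric.sphere (0 : E) 1,
        (inner ℂ (ψ : E) ((w ^ 2 • U + w • U') ψ)).re ^ 4 ∂μ.toSphere)) := by
    simp only [hpt, average_eq, smul_eq_mul]
    rw [integral_const_mul, integral_add (by exact (hint _).add (hint _)) (hint _),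
      integral_add (hint _) (hint _)]
    ring
  apply Complex.ofReal_injective
  rw [hsum]
  push_cast
  rw [e1, e2, e3, ← Complex.ofReal_pow, hq, ← add_div, ← add_div, ← mul_div_assoc, ← hN]
  congr 1
  have hw4 : w ^ 4 = w := by linear_combination w * hw3
  have hw2 : (w ^ 2) ^ 2 = w := by linear_combination w * hw3
  have hw8 : (w ^ 2) ^ 4 = w ^ 2 := by linear_combination (w ^ 5 + w ^ 2) * hw3
  rw [hw2, hw4, hw8]
  -- Terms with a nontrivial power of w, including tr U⁴, cancel over the three pairs. What survives
  -- is (3(12N² + 6|q|²) + 6·18N)/18.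
  linear_combination (18⁻¹ : ℂ) * (3 * ((q ^ 2 + (starRingEnd ℂ) q ^ 2) * (w ^ 2 - w + 1) +
    4 * N * (q + (starRingEnd ℂ) q) + 4 * q * (starRingEnd ℂ) q * (w - 1)) +
    6 * (t + 4 * q + 4 * (starRingEnd ℂ) q + (starRingEnd ℂ) t)) * hw

end SphereAverage

/-! ### Displacement operators, characters and the symplectic form. -/

lemma AddChar.map_finsetSum_eq_prod {ι A M : Type*} [AddCommMonoid A] [CommMonoid M]
    (χ : AddChar A M) (s : Finset ι) (f : ι → A) : χ (∑ i ∈ s, f i) = ∏ i ∈ s, χ (f i) := by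
  induction s using Finset.cons_induction with
  | empty => simp
  | cons i s hi ih => rw [Finset.sum_cons, Finset.prod_cons, AddChar.map_add_eq_mul, ih]

open Classical in
lemma sum_ite_mem_eq_ncard_mul {α R : Type*} [Fintype α] [Semiring R] (A : Set α) (c : R) :
    (∑ a, if a ∈ A then c else 0) = A.ncard * c := by
  rw [← Finset.sum_filter, Finset.sum_const, nsmul_eq_mul, ← Set.ncard_coe_finset]
  simp

section Weyl

variable {d n : ℕ}

lemma norm_tauPhase : ‖tauPhase d‖ = 1 := by
  have h : (Real.pi * Complex.I / d : ℂ) = ((Real.pi / d : ℝ) : ℂ) * Complex.I := by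
    push_cast
    ring
  rw [tauPhase, norm_neg, h, Complex.norm_exp_ofReal_mul_I]

/-- The translation part of a phase space point. -/
def PhaseSpace.position (a : PhaseSpace d n) : Fin n → ZMod d := fun i => (a i).1

/-- The modulation part of a phase space point. -/
def PhaseSpace.momentum (a : PhaseSpace d n) : Fin n → ZMod d := fun i => (a i).2

lemma symplecticForm_eq_dotProduct (a b : PhaseSpace d n) :
    symplecticForm a b = a.momentum ⬝ᵥ b.position - b.momentum ⬝ᵥ a.position := by
  simp [symplecticForm, dotProduct, PhaseSpace.momentum, PhaseSpace.position, mul_comm]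

lemma exists_symplecticForm_ne_zero {s : PhaseSpace d n} (hs : s ≠ 0) :
    ∃ a, symplecticForm a s ≠ 0 := by
  obtain ⟨i, hi⟩ := Function.ne_iff.1 hs
  by_cases h1 : (s i).1 = 0
  · have h2 : (s i).2 ≠ 0 := fun h => hi (Prod.ext h1 h)
    refine ⟨Pi.single i (1, 0), ?_⟩
    rw [symplecticForm, Finset.sum_eq_single i]
    · simpa using h2
    · intro j _ hj
      simp [hj]
    · simp
  · refine ⟨Pi.single i (0, 1), ?_⟩
    rw [symplecticForm, Finset.sum_eq_single i]
    · simpa using h1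
    · intro j _ hj
      simp [hj]
    · simp

lemma symplecticForm_add_left (a b c : PhaseSpace d n) :
    symplecticForm (a + b) c = symplecticForm a c + symplecticForm b c := by
  simp only [symplecticForm, ← Finset.sum_add_distrib]
  exact Finset.sum_congr rfl fun i _ => by
    simp only [Pi.add_apply, Prod.fst_add, Prod.snd_add]
    ring

lemma symplecticForm_add_right (a b c : PhaseSpace d n) :
    symplecticForm a (b + c) = symplecticForm a b + symplecticForm a c := by
  simp only [symplecticForm, ← Finset.sum_add_distrib]
  exact Finset.sum_congr rfl fun i _ => by
    simp only [Pi.add_apply, Prod.fst_add, Prod.snd_add]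
    ring

/-- The phase `∏ i, τ ^ (a_{i,1} a_{i,2})` of a displacement operator. -/
noncomputable def displacementPhase (a : PhaseSpace d n) : ℂ :=
  ∏ i, tauPhase d ^ ((a i).1.val * (a i).2.val)

lemma norm_displacementPhase (a : PhaseSpace d n) : ‖displacementPhase a‖ = 1 := by
  simp [displacementPhase, norm_prod, norm_tauPhase]

lemma displacementPhase_ne_zero (a : PhaseSpace d n) : displacementPhase a ≠ 0 := by
  rw [← norm_ne_zero_iff, norm_displacementPhase]
  exact one_ne_zero

variable [NeZero d]

/-- Moves powers of ω to a character of `ZMod d`, where exponents add without carries. The powers of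
τ depend on representatives, but they enter only as unimodular scalars. -/
lemma omegaPhase_pow (k : ℕ) : omegaPhase d ^ k = ZMod.stdAddChar (k : ZMod d) := by
  have h := ZMod.stdAddChar_coe (N := d) (k : ℤ)
  rw [Int.cast_natCast] at h
  rw [h, omegaPhase, ← Complex.exp_nat_mul]
  congr 1
  push_cast
  ring

lemma norm_stdAddChar (k : ZMod d) : ‖ZMod.stdAddChar k‖ = 1 := by
  rw [ZMod.stdAddChar_apply, Circle.norm_coe]

lemma shiftMatrix_pow (k : ℕ) :
    shiftMatrix d ^ k = Matrix.of fun j l => if j = l + (k : ZMod d) then 1 else 0 := by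
  induction k with
  | zero =>
    ext j l
    simp [Matrix.one_apply]
  | succ k ih =>
    ext j l
    rw [pow_succ, ih, Matrix.mul_apply, Finset.sum_eq_single (l + 1)]
    · simp [shiftMatrix, add_assoc, add_comm (1 : ZMod d)]
    · intro x _ hx
      simp [shiftMatrix, hx]
    · simp

lemma displacementOne_apply (a : ZMod d × ZMod d) (j l : ZMod d) :
    displacementOne d a j l = if j = l + a.1 then
      tauPhase d ^ (a.1.val * a.2.val) * ZMod.stdAddChar (a.2 * l) else 0 := by
  rw [displacementOne, Matrix.smul_apply, shiftMatrix_pow, clockMatrix, Matrix.diagonal_pow,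
    Matrix.mul_diagonal]
  have h : (fun k : ZMod d => omegaPhase d ^ k.val) ^ a.2.val =
      fun k => ZMod.stdAddChar (a.2 * k) := by
    ext k
    rw [Pi.pow_apply, ← pow_mul, omegaPhase_pow, Nat.cast_mul, ZMod.natCast_zmod_val,
      ZMod.natCast_zmod_val, mul_comm]
  simp only [h, Matrix.of_apply, ZMod.natCast_zmod_val, smul_eq_mul]
  split_ifs <;> simp

lemma displacement_apply (a : PhaseSpace d n) (x y : Fin n → ZMod d) :
    displacement a x y = if x = y + a.position then
      displacementPhase a * ZMod.stdAddChar (a.momentum ⬝ᵥ y) else 0 := by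
  simp only [displacement, Matrix.of_apply, displacementOne_apply]
  split_ifs with h
  · have : ∀ i, x i = y i + (a i).1 := fun i => congrFun h i
    simp only [this, if_true, Finset.prod_mul_distrib, displacementPhase, dotProduct]
    rw [AddChar.map_finsetSum_eq_prod]
    rfl
  · obtain ⟨i, hi⟩ := Function.ne_iff.1 h
    exact Finset.prod_eq_zero (Finset.mem_univ i) (if_neg hi)

/-- The displacement operator as a linear map. -/
noncomputable def weylOperator (a : PhaseSpace d n) : QuditSpace d n →ₗ[ℂ] QuditSpace d n :=
  Matrix.toEuclideanLin (displacement a)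

lemma weylOperator_apply (a : PhaseSpace d n) (v : QuditSpace d n) (x : Fin n → ZMod d) :
    weylOperator a v x = displacementPhase a *
      ZMod.stdAddChar (a.momentum ⬝ᵥ (x - a.position)) * v (x - a.position) := by
  rw [weylOperator, Matrix.ofLp_toLpLin, Matrix.toLin'_apply, Matrix.mulVec, dotProduct,
    Finset.sum_eq_single (x - a.position)]
  · simp [displacement_apply]
  · intro y _ hy
    rw [displacement_apply, if_neg, zero_mul]
    rintro rfl
    simp at hy
  · simp

lemma weylOperator_zero : weylOperator (0 : PhaseSpace d n) = 1 := by
  ext v x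
  have h0 : displacementPhase (0 : PhaseSpace d n) = 1 := by simp [displacementPhase]
  have h1 : (0 : PhaseSpace d n).position = 0 := rfl
  have h2 : (0 : PhaseSpace d n).momentum = 0 := rfl
  simp [weylOperator_apply, h0, h1, h2]

/-- The phase in the composition law of displacement operators. -/
noncomputable def weylCocycle (a b : PhaseSpace d n) : ℂ :=
  displacementPhase a * displacementPhase b * (displacementPhase (a + b))⁻¹ *
    ZMod.stdAddChar (a.momentum ⬝ᵥ b.position)

lemma norm_weylCocycle (a b : PhaseSpace d n) : ‖weylCocycle a b‖ = 1 := by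
  simp [weylCocycle, norm_displacementPhase]

lemma weylOperator_mul (a b : PhaseSpace d n) :
    weylOperator a * weylOperator b = weylCocycle a b • weylOperator (a + b) := by
  ext v x
  have h1 : (a + b).position = a.position + b.position := rfl
  have h2 : (a + b).momentum = a.momentum + b.momentum := rfl
  have h3 : a.momentum ⬝ᵥ (x - a.position) =
      a.momentum ⬝ᵥ b.position + a.momentum ⬝ᵥ (x - (a.position + b.position)) := by
    rw [← dotProduct_add]
    congr 1
    abel
  have h4 := displacementPhase_ne_zero (a + b)
  simp only [Module.End.mul_apply, LinearMap.smul_apply, PiLp.smul_apply, weylOperator_apply,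
    weylCocycle, h1, h2, h3, add_dotProduct, AddChar.map_add_eq_mul, sub_sub, smul_eq_mul]
  field_simp

lemma weylOperator_mul_comm (a b : PhaseSpace d n) : weylOperator a * weylOperator b =
    ZMod.stdAddChar (symplecticForm a b) • (weylOperator b * weylOperator a) := by
  rw [weylOperator_mul, weylOperator_mul, smul_smul, add_comm b a]
  congr 1
  have h : a.momentum ⬝ᵥ b.position = symplecticForm a b + b.momentum ⬝ᵥ a.position := by
    rw [symplecticForm_eq_dotProduct]
    ring
  rw [weylCocycle, weylCocycle, h, AddChar.map_add_eq_mul, add_comm b a]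
  ring

lemma norm_weylOperator_apply (a : PhaseSpace d n) (v : QuditSpace d n) :
    ‖weylOperator a v‖ = ‖v‖ := by
  rw [← sq_eq_sq₀ (norm_nonneg _) (norm_nonneg _), EuclideanSpace.norm_sq_eq,
    EuclideanSpace.norm_sq_eq]
  simp only [weylOperator_apply, norm_mul, norm_displacementPhase, norm_stdAddChar, one_mul]
  exact (Equiv.subRight a.position).sum_comp fun x => ‖v x‖ ^ 2

lemma inner_weylOperator_weylOperator (a : PhaseSpace d n) (v w : QuditSpace d n) :
    inner ℂ (weylOperator a v) (weylOperator a w) = inner ℂ v w :=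
  LinearIsometry.inner_map_map ⟨weylOperator a, norm_weylOperator_apply a⟩ v w

lemma sum_stdAddChar_comp_eq_zero {G : Type*} [AddCommGroup G] [Fintype G] (φ : G →+ ZMod d)
    (hφ : ∃ g, φ g ≠ 0) : ∑ g, ZMod.stdAddChar (φ g) = 0 := by
  refine (AddChar.sum_eq_zero_iff_ne_zero
    (ψ := (ZMod.stdAddChar (N := d)).compAddMonoidHom φ)).2 fun h => ?_
  obtain ⟨g, hg⟩ := hφ
  have := DFunLike.congr_fun h g
  rw [AddChar.compAddMonoidHom_apply, AddChar.zero_apply,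
    ← AddChar.map_zero_eq_one (ZMod.stdAddChar (N := d))] at this
  exact hg (ZMod.injective_stdAddChar this)

/-- Either the translation part is nonzero and no basis vector is fixed, or the operator is diagonal
and its trace is a multiple of a nontrivial character sum. -/
lemma trace_weylOperator_of_ne_zero {a : PhaseSpace d n} (ha : a ≠ 0) :
    LinearMap.trace ℂ _ (weylOperator a) = 0 := by
  rw [LinearMap.trace_eq_sum_inner _ (EuclideanSpace.basisFun _ ℂ)]
  simp only [EuclideanSpace.basisFun_apply, EuclideanSpace.inner_single_left, weylOperator_apply,
    map_one, one_mul, PiLp.single_apply]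
  by_cases hp : a.position = 0
  · have hm : ∃ i, a.momentum i ≠ 0 := by
      by_contra! h
      exact ha (funext fun i => Prod.ext (congrFun hp i) (h i))
    simp only [hp, sub_zero, if_true, mul_one, ← Finset.mul_sum]
    rw [mul_eq_zero]
    right
    obtain ⟨i, hi⟩ := hm
    exact sum_stdAddChar_comp_eq_zero
      (AddMonoidHom.mk' (fun x => a.momentum ⬝ᵥ x) fun x y => dotProduct_add _ x y)
      ⟨Pi.single i 1, by simpa using hi⟩
  · refine Finset.sum_eq_zero fun x _ => ?_
    rw [if_neg, mul_zero]
    simpa using hp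

open Classical in
/-- The order of a subgroup times that of its symplectic complement is the order of phase space. -/
lemma card_mul_card_symplecticPerp (S : AddSubgroup (PhaseSpace d n)) :
    Nat.card S * (symplecticPerp S).ncard = (d ^ n) ^ 2 := by
  -- The double character sum is evaluated twice: summing over a first leaves s = 0 by
  -- nondegeneracy, summing over s first leaves a ∈ S^⊥.
  have h1 : ∑ a : PhaseSpace d n, ∑ s : S, ZMod.stdAddChar (symplecticForm a (s : PhaseSpace d n))
      = ((d ^ n) ^ 2 : ℕ) := by
    rw [Finset.sum_comm, Finset.sum_eq_single (0 : S)]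
    · simp [symplecticForm, ZMod.card, ← sq, ← pow_mul, mul_comm]
    · intro s _ hs
      obtain ⟨a, ha⟩ := exists_symplecticForm_ne_zero (s := (s : PhaseSpace d n)) (by simpa using hs)
      exact sum_stdAddChar_comp_eq_zero (AddMonoidHom.mk'
        (fun a => symplecticForm a (s : PhaseSpace d n)) fun a b => symplecticForm_add_left a b _)
        ⟨a, ha⟩
    · simp
  have h2 : ∀ a : PhaseSpace d n,
      ∑ s : S, ZMod.stdAddChar (symplecticForm a (s : PhaseSpace d n)) =
        if a ∈ symplecticPerp S then (Nat.card S : ℂ) else 0 := by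
    intro a
    split_ifs with h
    · have : ∀ s : S, symplecticForm a (s : PhaseSpace d n) = 0 := fun s => h s s.2
      simp [this]
    · simp only [symplecticPerp, Set.mem_ofPred_eq, not_forall] at h
      obtain ⟨s, hs, hne⟩ := h
      exact sum_stdAddChar_comp_eq_zero (AddMonoidHom.mk'
        (fun s : S => symplecticForm a (s : PhaseSpace d n))
        fun s t => symplecticForm_add_right a s t) ⟨⟨s, hs⟩, hne⟩
  simp only [h2] at h1
  rw [sum_ite_mem_eq_ncard_mul, mul_comm] at h1
  exact_mod_cast h1

end Weyl

lemma norm_trace_displacement_mul_pureState {d n : ℕ} [NeZero d] (a : PhaseSpace d n)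
    (ψ : QuditSpace d n) :
    ‖((displacement a)ᴴ * pureState ψ).trace‖ = ‖inner ℂ ψ (weylOperator a ψ)‖ := by
  have h : inner ℂ (weylOperator a ψ) ψ = star (displacement a *ᵥ ψ) ⬝ᵥ (ψ : _ → ℂ) := by
    rw [weylOperator, EuclideanSpace.inner_eq_star_dotProduct, dotProduct_comm]
    rfl
  rw [norm_inner_symm, h, pureState, Matrix.mul_vecMulVec, Matrix.trace_vecMulVec,
    Matrix.star_mulVec, dotProduct_comm, ← Matrix.dotProduct_mulVec]
  rfl

lemma stabilizerEntropy_eq_sum_inner {d n : ℕ} [NeZero d] (ψ : QuditSpace d n) :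
    stabilizerEntropy ψ =
      1 - 1 / (d : ℝ) ^ n * ∑ a : PhaseSpace d n, ‖inner ℂ ψ (weylOperator a ψ)‖ ^ 4 := by
  simp only [stabilizerEntropy, norm_trace_displacement_mul_pureState]

/-! ### Displacement operators compressed to a stabilizer code. -/

section Code

variable {d n : ℕ} [NeZero d] {S : AddSubgroup (PhaseSpace d n)}

lemma mem_stabilizerCodespace_zero_iff {v : QuditSpace d n} :
    v ∈ stabilizerCodespace S 0 ↔ ∀ a ∈ S, weylOperator a v = v := by
  simp [stabilizerCodespace, weylOperator, Submodule.mem_iInf, LinearMap.mem_ker, sub_eq_zero]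

variable {E : Type*} [NormedAddCommGroup E] [InnerProductSpace ℂ E]
  {V : E →ₗᵢ[ℂ] QuditSpace d n}

lemma weylOperator_encode (hV : LinearMap.range V.toLinearMap = stabilizerCodespace S 0)
    {a : PhaseSpace d n} (ha : a ∈ S) (x : E) : weylOperator a (V x) = V x :=
  mem_stabilizerCodespace_zero_iff.1 (hV ▸ LinearMap.mem_range_self V.toLinearMap x) a ha

lemma exists_encode_eq (hV : LinearMap.range V.toLinearMap = stabilizerCodespace S 0)
    {v : QuditSpace d n} (hv : ∀ a ∈ S, weylOperator a v = v) : ∃ x, V x = v := by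
  have : v ∈ LinearMap.range V.toLinearMap := hV ▸ mem_stabilizerCodespace_zero_iff.2 hv
  exact this

/-- Both sides of the composition law fix a nonzero code vector, so nontriviality of the code forces
the phases on S to be trivial without computing any τ. -/
lemma weylCocycle_eq_one [Nontrivial E]
    (hV : LinearMap.range V.toLinearMap = stabilizerCodespace S 0)
    {a b : PhaseSpace d n} (ha : a ∈ S) (hb : b ∈ S) : weylCocycle a b = 1 := by
  obtain ⟨x, hx⟩ := exists_ne (0 : E)
  have h := DFunLike.congr_fun (weylOperator_mul a b) (V x)
  rw [Module.End.mul_apply, LinearMap.smul_apply, weylOperator_encode hV hb,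
    weylOperator_encode hV ha, weylOperator_encode hV (S.add_mem ha hb)] at h
  have hne : V x ≠ 0 := fun h0 => hx (V.injective (by rw [h0, map_zero]))
  refine smul_left_injective ℂ hne ?_
  simp only [one_smul]
  exact h.symm

/-- Some s ∈ S commutes with b only up to a phase ω^[b,s] ≠ 1. As D_s fixes code vectors, the
expectation equals that phase times itself. -/
lemma inner_weylOperator_encode_of_notMem_perp
    (hV : LinearMap.range V.toLinearMap = stabilizerCodespace S 0)
    {b : PhaseSpace d n} (hb : b ∉ symplecticPerp S) (x : E) :
    inner ℂ (V x) (weylOperator b (V x)) = 0 := by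
  simp only [symplecticPerp, Set.mem_ofPred_eq, not_forall] at hb
  obtain ⟨s, hs, hne⟩ := hb
  have h1 : weylOperator b (V x) =
      ZMod.stdAddChar (symplecticForm b s) • weylOperator s (weylOperator b (V x)) := by
    have h := DFunLike.congr_fun (weylOperator_mul_comm b s) (V x)
    rwa [Module.End.mul_apply, weylOperator_encode hV hs] at h
  have h2 : inner ℂ (V x) (weylOperator s (weylOperator b (V x))) =
      inner ℂ (V x) (weylOperator b (V x)) := by
    have h := inner_weylOperator_weylOperator s (V x) (weylOperator b (V x))
    rwa [weylOperator_encode hV hs x] at h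
  have h3 : inner ℂ (V x) (weylOperator b (V x)) = ZMod.stdAddChar (symplecticForm b s) *
      inner ℂ (V x) (weylOperator b (V x)) := by
    conv_lhs => rw [h1, inner_smul_right, h2]
  by_contra h
  refine hne (ZMod.injective_stdAddChar ?_)
  rw [AddChar.map_zero_eq_one]
  exact (mul_right_cancel₀ h ((one_mul _).trans h3)).symm

variable [FiniteDimensional ℂ E]

lemma adjoint_encode_apply (x : E) : LinearMap.adjoint V.toLinearMap (V x) = x := by
  refine ext_inner_left ℂ fun y => ?_
  rw [LinearMap.adjoint_inner_right]
  exact V.inner_map_map y x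

/-- The compression `V† D_b V` of a displacement operator to the encoded space. -/
noncomputable def encodedOperator (V : E →ₗᵢ[ℂ] QuditSpace d n) (b : PhaseSpace d n) :
    E →ₗ[ℂ] E :=
  LinearMap.adjoint V.toLinearMap ∘ₗ weylOperator b ∘ₗ V.toLinearMap

lemma inner_encodedOperator (b : PhaseSpace d n) (x y : E) :
    inner ℂ x (encodedOperator V b y) = inner ℂ (V x) (weylOperator b (V y)) := by
  rw [encodedOperator, LinearMap.comp_apply, LinearMap.adjoint_inner_right]
  rfl

lemma weylOperator_comm_of_mem_perp {a b : PhaseSpace d n} (hb : b ∈ symplecticPerp S)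
    (ha : a ∈ S) : weylOperator b * weylOperator a = weylOperator a * weylOperator b := by
  rw [weylOperator_mul_comm, hb a ha, AddChar.map_zero_eq_one, one_smul]

/-- For b ∈ S^⊥, D_b commutes with all stabilizers and so preserves the code, on which V† inverts V.
Hence compression loses nothing and products may be computed in the large space. -/
lemma encode_encodedOperator (hV : LinearMap.range V.toLinearMap = stabilizerCodespace S 0)
    {b : PhaseSpace d n} (hb : b ∈ symplecticPerp S) (x : E) :
    V (encodedOperator V b x) = weylOperator b (V x) := by
  obtain ⟨y, hy⟩ := exists_encode_eq hV (v := weylOperator b (V x)) fun a ha => by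
    rw [← Module.End.mul_apply, ← weylOperator_comm_of_mem_perp hb ha, Module.End.mul_apply,
      weylOperator_encode hV ha]
  rw [← hy, encodedOperator]
  congr 1
  simp only [LinearMap.comp_apply]
  change LinearMap.adjoint V.toLinearMap (weylOperator b (V x)) = y
  rw [← hy, adjoint_encode_apply]

lemma adjoint_mul_encodedOperator (hV : LinearMap.range V.toLinearMap = stabilizerCodespace S 0)
    {b : PhaseSpace d n} (hb : b ∈ symplecticPerp S) :
    LinearMap.adjoint (encodedOperator V b) * encodedOperator V b = 1 := by
  ext x
  refine ext_inner_left ℂ fun y => ?_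
  rw [Module.End.mul_apply, LinearMap.adjoint_inner_right, ← V.inner_map_map,
    encode_encodedOperator hV hb, encode_encodedOperator hV hb, inner_weylOperator_weylOperator,
    V.inner_map_map]
  rfl

lemma encodedOperator_sq (hV : LinearMap.range V.toLinearMap = stabilizerCodespace S 0)
    {b : PhaseSpace d n} (hb : b ∈ symplecticPerp S) :
    encodedOperator V b ^ 2 = weylCocycle b b • encodedOperator V (2 • b) := by
  have h2 : 2 • b ∈ symplecticPerp S := fun s hs => by
    rw [two_nsmul, symplecticForm_add_left, hb s hs, add_zero]
  ext x
  apply V.injective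
  rw [pow_two, Module.End.mul_apply, encode_encodedOperator hV hb, encode_encodedOperator hV hb,
    LinearMap.smul_apply, map_smul, encode_encodedOperator hV h2, ← Module.End.mul_apply,
    weylOperator_mul, two_nsmul]
  rfl

lemma encodedOperator_of_mem (hV : LinearMap.range V.toLinearMap = stabilizerCodespace S 0)
    {b : PhaseSpace d n} (hb : b ∈ S) : encodedOperator V b = 1 := by
  ext x
  refine ext_inner_left ℂ fun y => ?_
  rw [inner_encodedOperator, weylOperator_encode hV hb, V.inner_map_map]
  rfl

-- The sum P of D_s over S is |S| times the projection onto the code, so cyclicity of the trace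
-- gives |S| tr(V†D_bV) = tr(D_b P).
open Classical in
lemma card_mul_trace_encodedOperator [Nontrivial E]
    (hV : LinearMap.range V.toLinearMap = stabilizerCodespace S 0)
    {b : PhaseSpace d n} (hb : b ∈ symplecticPerp S) :
    Nat.card S * LinearMap.trace ℂ E (encodedOperator V b) =
      ∑ s : S, weylCocycle b s *
        LinearMap.trace ℂ _ (weylOperator (b + (s : PhaseSpace d n))) := by
  set P : QuditSpace d n →ₗ[ℂ] QuditSpace d n := ∑ s : S, weylOperator (s : PhaseSpace d n)
    with hP
  have hPV : P ∘ₗ V.toLinearMap = (Nat.card S : ℂ) • V.toLinearMap := by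
    ext1 x
    have : ∀ s : S, weylOperator (s : PhaseSpace d n) (V x) = V x :=
      fun s => weylOperator_encode hV s.2 x
    simp [hP, this, Nat.cast_smul_eq_nsmul]
  have hbP : weylOperator b * P = P * weylOperator b := by
    rw [hP, Finset.mul_sum, Finset.sum_mul]
    exact Finset.sum_congr rfl fun s _ => weylOperator_comm_of_mem_perp hb s.2
  -- P maps into the code: D_a P = P because translation by a permutes S and the cocycle is trivial
  -- there.
  have hVP : V.toLinearMap ∘ₗ (LinearMap.adjoint V.toLinearMap ∘ₗ P) = P := by
    ext1 v
    obtain ⟨y, hy⟩ := exists_encode_eq hV (v := P v) fun a ha => by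
      rw [← Module.End.mul_apply, hP, Finset.mul_sum]
      congr 1
      refine Eq.trans ?_ (Equiv.sum_comp (Equiv.addLeft (⟨a, ha⟩ : S))
        fun s : S => weylOperator (s : PhaseSpace d n))
      refine Finset.sum_congr rfl fun s _ => ?_
      rw [weylOperator_mul, weylCocycle_eq_one hV ha s.2, one_smul]
      rfl
    simp only [LinearMap.comp_apply]
    rw [← hy, adjoint_encode_apply]
    rfl
  have h1 : LinearMap.trace ℂ _ (weylOperator b * P) =
      Nat.card S * LinearMap.trace ℂ E (encodedOperator V b) := by
    calc LinearMap.trace ℂ _ (weylOperator b * P)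
        = LinearMap.trace ℂ _ ((weylOperator b ∘ₗ V.toLinearMap) ∘ₗ
            (LinearMap.adjoint V.toLinearMap ∘ₗ P)) := by
          rw [LinearMap.comp_assoc, hVP]
          rfl
      _ = LinearMap.trace ℂ _ ((LinearMap.adjoint V.toLinearMap ∘ₗ P) ∘ₗ
            (weylOperator b ∘ₗ V.toLinearMap)) := LinearMap.trace_comp_comm' _ _
      _ = LinearMap.trace ℂ _ (LinearMap.adjoint V.toLinearMap ∘ₗ weylOperator b ∘ₗ
            (P ∘ₗ V.toLinearMap)) := by
          have : P ∘ₗ weylOperator b = weylOperator b ∘ₗ P := hbP.symm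
          rw [LinearMap.comp_assoc, ← LinearMap.comp_assoc _ _ P, this, LinearMap.comp_assoc]
      _ = _ := by
          rw [hPV, LinearMap.comp_smul, LinearMap.comp_smul, map_smul, smul_eq_mul]
          rfl
  rw [← h1, hP, Finset.mul_sum, map_sum]
  exact Finset.sum_congr rfl fun s _ => by rw [weylOperator_mul, map_smul, smul_eq_mul]

lemma trace_encodedOperator_of_notMem [Nontrivial E]
    (hV : LinearMap.range V.toLinearMap = stabilizerCodespace S 0)
    {b : PhaseSpace d n} (hb : b ∈ symplecticPerp S) (hbS : b ∉ S) :
    LinearMap.trace ℂ E (encodedOperator V b) = 0 := by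
  have h := card_mul_trace_encodedOperator hV hb
  rw [Finset.sum_eq_zero, mul_eq_zero] at h
  · exact h.resolve_left (Nat.cast_ne_zero.2 Nat.card_pos.ne')
  · intro s _
    rw [trace_weylOperator_of_ne_zero, mul_zero]
    intro h0
    exact hbS (by rw [eq_neg_of_add_eq_zero_left h0]; exact S.neg_mem s.2)

/-- The dimension of a stabilizer code. -/
lemma finrank_mul_card [Nontrivial E]
    (hV : LinearMap.range V.toLinearMap = stabilizerCodespace S 0) :
    Module.finrank ℂ E * Nat.card S = d ^ n := by
  have h0 : (0 : PhaseSpace d n) ∈ symplecticPerp S := fun s _ => by simp [symplecticForm]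
  -- At b = 0 only s = 0 has nonzero trace, namely d^n.
  have h := card_mul_trace_encodedOperator hV h0
  rw [encodedOperator_of_mem hV S.zero_mem, LinearMap.trace_one, Finset.sum_eq_single (0 : S)] at h
  · have hc : weylCocycle (0 : PhaseSpace d n) ((0 : S) : PhaseSpace d n) = 1 :=
      weylCocycle_eq_one hV S.zero_mem S.zero_mem
    have hz : (0 : PhaseSpace d n) + ((0 : S) : PhaseSpace d n) = 0 := add_zero 0
    rw [hc, hz, weylOperator_zero, LinearMap.trace_one, one_mul] at h
    have hf : Module.finrank ℂ (QuditSpace d n) = d ^ n := by simp [ZMod.card]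
    rw [hf] at h
    rw [mul_comm]
    exact_mod_cast h
  · intro s _ hs
    rw [trace_weylOperator_of_ne_zero, mul_zero]
    simpa using hs
  · simp

end Code

/-! ### Average stabilizer entropy of a code. -/

lemma mem_halfPerpSet_of_mem {d n : ℕ} {S : AddSubgroup (PhaseSpace d n)}
    (hS : IsTotallyIsotropic S) {b : PhaseSpace d n} (hb : b ∈ S) :
    b ∈ halfPerpSet S :=
  ⟨S.nsmul_mem hb 2, fun s hs => hS b hb s hs⟩

section Average

variable {d n : ℕ} [NeZero d] {S : AddSubgroup (PhaseSpace d n)}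
  {E : Type*} [NormedAddCommGroup E] [InnerProductSpace ℂ E] [NormedSpace ℝ E]
  [MeasurableSpace E] [BorelSpace E] [FiniteDimensional ℝ E] (μ : Measure E) [μ.IsAddHaarMeasure]
  {V : E →ₗᵢ[ℂ] QuditSpace d n}

lemma integrable_weylOperator_pow_four (b : PhaseSpace d n) :
    Integrable (fun ψ : Metric.sphere (0 : E) 1 =>
      ‖inner ℂ (V ψ) (weylOperator b (V ψ))‖ ^ 4) μ.toSphere := by
  have h1 : Continuous (weylOperator b) := (weylOperator b).continuous_of_finiteDimensional
  have h2 : Continuous V := V.continuous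
  refine Continuous.integrable_of_hasCompactSupport (by fun_prop) ?_
  exact HasCompactSupport.of_compactSpace _

lemma integrable_stabilizerEntropy : Integrable (fun ψ : Metric.sphere (0 : E) 1 =>
    stabilizerEntropy (V ψ)) μ.toSphere := by
  simp only [stabilizerEntropy_eq_sum_inner]
  exact (integrable_const _).sub
    ((integrable_finsetSum _ fun b _ => integrable_weylOperator_pow_four μ b).const_mul _)

variable [IsScalarTower ℝ ℂ E] [FiniteDimensional ℂ E]

open Classical in
/-- The average fourth power of the expectation value of a displacement operator in a uniformly
distributed code state. -/
lemma average_sphere_weylOperator_pow_four [Nontrivial E] (hS : IsTotallyIsotropic S)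
    (hV : LinearMap.range V.toLinearMap = stabilizerCodespace S 0) {N : ℝ}
    (hN : N = Module.finrank ℂ E) (b : PhaseSpace d n) :
    ⨍ ψ : Metric.sphere (0 : E) 1, ‖inner ℂ (V ψ) (weylOperator b (V ψ))‖ ^ 4 ∂μ.toSphere =
      (if b ∈ (S : Set (PhaseSpace d n)) then
        1 - 2 / ((N + 1) * (N + 2)) - N / ((N + 1) * (N + 2) * (N + 3)) else 0) +
      (if b ∈ symplecticPerp S then 2 / ((N + 1) * (N + 2)) else 0) +
      (if b ∈ halfPerpSet S then N / ((N + 1) * (N + 2) * (N + 3)) else 0) := by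
  have hNpos : 0 < N := by
    rw [hN]
    exact_mod_cast Module.finrank_pos
  by_cases hbS : b ∈ S
  · have hbA := mem_halfPerpSet_of_mem hS hbS
    have h1 : ∀ ψ : Metric.sphere (0 : E) 1,
        ‖inner ℂ (V ψ) (weylOperator b (V ψ))‖ ^ 4 = 1 := fun ψ => by
      rw [weylOperator_encode hV hbS, V.inner_map_map, inner_self_eq_norm_sq_to_K]
      simp
    have : NeZero μ.toSphere := ⟨Measure.toSphere_ne_zero μ⟩
    simp only [h1, average_const]
    -- All three indicators are on, since S ⊆ A_S ⊆ S^⊥; the amounts subtracted in the first cancel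
    -- the other two.
    rw [if_pos hbA, if_pos hbA.2, if_pos (by exact hbS)]
    ring
  by_cases hbP : b ∈ symplecticPerp S
  · simp only [← inner_encodedOperator]
    rw [average_sphere_unitary_pow_four μ (adjoint_mul_encodedOperator hV hbP)
      (trace_encodedOperator_of_notMem hV hbP hbS), encodedOperator_sq hV hbP, map_smul,
      norm_smul, norm_weylCocycle, one_mul, if_neg (by exact hbS), if_pos hbP, ← hN]
    -- Up to a unimodular cocycle, U² is the compression of D_(2b): the identity if 2b ∈ S,
    -- traceless otherwise.
    by_cases h2 : 2 • b ∈ S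
    · rw [encodedOperator_of_mem hV h2, LinearMap.trace_one, if_pos ⟨h2, hbP⟩,
        Complex.norm_natCast, ← hN]
      field_simp
      ring
    · have h2P : 2 • b ∈ symplecticPerp S := fun s hs => by
        rw [two_nsmul, symplecticForm_add_left, hbP s hs, add_zero]
      rw [trace_encodedOperator_of_notMem hV h2P h2, if_neg fun h => h2 h.1]
      field_simp
      simp
      ring
  · simp only [inner_weylOperator_encode_of_notMem_perp hV hbP]
    rw [if_neg (by exact hbS), if_neg hbP, if_neg fun h => hbP h.2]
    simp

/-- The average stabilizer entropy of the states of a stabilizer code. -/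
lemma average_stabilizerEntropy [Nontrivial E] (hS : IsTotallyIsotropic S)
    (hV : LinearMap.range V.toLinearMap = stabilizerCodespace S 0) {N : ℝ}
    (hN : N = Module.finrank ℂ E) :
    ⨍ ψ : Metric.sphere (0 : E) 1, stabilizerEntropy (V ψ) ∂μ.toSphere =
      1 - 1 / N - 2 * (N - 1) / (N * (N + 2)) + 1 / ((N + 1) * (N + 2) * (N + 3)) -
        (halfPerpSet S).ncard * N / ((d : ℝ) ^ n * ((N + 1) * (N + 2) * (N + 3))) := by
  classical
  have hNpos : 0 < N := by
    rw [hN]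
    exact_mod_cast Module.finrank_pos
  have hd : (0 : ℝ) < (d : ℝ) ^ n := by
    have := Nat.pos_of_ne_zero (NeZero.ne d)
    positivity
  have hcard : N * (Nat.card S : ℝ) = (d : ℝ) ^ n := by
    rw [hN]
    exact_mod_cast finrank_mul_card hV
  have hcS : ((S : Set (PhaseSpace d n)).ncard : ℝ) = (d : ℝ) ^ n / N := by
    rw [← hcard, mul_div_cancel_left₀ _ hNpos.ne']
    rfl
  have hcP : ((symplecticPerp S).ncard : ℝ) = N * (d : ℝ) ^ n := by
    have h : (Nat.card S : ℝ) * (symplecticPerp S).ncard = ((d : ℝ) ^ n) ^ 2 := by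
      exact_mod_cast card_mul_card_symplecticPerp S
    have : (Nat.card S : ℝ) ≠ 0 := Nat.cast_ne_zero.2 Nat.card_pos.ne'
    refine mul_left_cancel₀ this ?_
    rw [h, ← hcard]
    ring
  have : NeZero μ.toSphere := ⟨Measure.toSphere_ne_zero μ⟩
  have hs0 : μ.toSphere.real Set.univ ≠ 0 := measureReal_univ_ne_zero
  have hsum : ⨍ ψ : Metric.sphere (0 : E) 1, stabilizerEntropy (V ψ) ∂μ.toSphere =
      1 - 1 / (d : ℝ) ^ n * ∑ b : PhaseSpace d n, ⨍ ψ : Metric.sphere (0 : E) 1,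
        ‖inner ℂ (V ψ) (weylOperator b (V ψ))‖ ^ 4 ∂μ.toSphere := by
    simp only [stabilizerEntropy_eq_sum_inner, average_eq, smul_eq_mul]
    rw [integral_sub (integrable_const _) ((integrable_finsetSum _ fun b _ =>
      integrable_weylOperator_pow_four μ b).const_mul _), integral_const_mul,
      integral_finsetSum _ fun b _ => integrable_weylOperator_pow_four μ b, integral_const,
      mul_sub, smul_eq_mul, mul_one, inv_mul_cancel₀ hs0, ← Finset.mul_sum]
    ring
  rw [hsum]
  simp only [average_sphere_weylOperator_pow_four μ hS hV hN, Finset.sum_add_distrib,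
    sum_ite_mem_eq_ncard_mul]
  rw [hcS, hcP]
  field_simp
  ring

end Average

/-! ### The small space as the trivial code, and two-torsion counts. -/

lemma stabilizerCodespace_bot {d n : ℕ} [NeZero d] :
    stabilizerCodespace (⊥ : AddSubgroup (PhaseSpace d n)) 0 = ⊤ := by
  rw [eq_top_iff]
  intro v _
  rw [mem_stabilizerCodespace_zero_iff]
  intro a ha
  rw [AddSubgroup.mem_bot.1 ha, weylOperator_zero]
  rfl

lemma halfPerpSet_bot {d n : ℕ} :
    halfPerpSet (⊥ : AddSubgroup (PhaseSpace d n)) = {a | 2 • a = 0} := by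
  ext a
  simp only [halfPerpSet, symplecticPerp, AddSubgroup.mem_bot, Set.mem_ofPred_eq, forall_eq,
    and_iff_left_iff_imp]
  intro
  simp [symplecticForm]

lemma ZMod.natCard_two_torsion_odd {D : ℕ} (hD : Odd D) :
    Nat.card {x : ZMod D // 2 • x = 0} = 1 := by
  have : Unique {x : ZMod D // 2 • x = 0} :=
    { default := ⟨0, by simp⟩
      uniq := fun ⟨x, hx⟩ => Subtype.ext (by
        have h2 : IsUnit ((2 : ℕ) : ZMod D) := (ZMod.isUnit_iff_coprime 2 D).2
          (Nat.coprime_two_left.2 hD)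
        rw [nsmul_eq_mul] at hx
        exact (h2.mul_right_eq_zero).1 hx) }
  exact Nat.card_unique

lemma ZMod.natCard_two_torsion_even {D : ℕ} [NeZero D] (hD : Even D) :
    Nat.card {x : ZMod D // 2 • x = 0} = 2 := by
  obtain ⟨k, hk⟩ := hD
  have hD0 : D ≠ 0 := NeZero.ne D
  have hk0 : ((k : ℕ) : ZMod D) ≠ 0 := by
    rw [Ne, ZMod.natCast_eq_zero_iff]
    exact Nat.not_dvd_of_pos_of_lt (by omega) (by omega)
  have hset : {x : ZMod D | 2 • x = 0} = {0, (k : ZMod D)} := by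
    ext x
    simp only [Set.mem_ofPred_eq, Set.mem_insert_iff, Set.mem_singleton_iff]
    constructor
    · intro hx
      rw [← ZMod.natCast_zmod_val x, nsmul_eq_mul, ← Nat.cast_mul,
        ZMod.natCast_eq_zero_iff] at hx
      obtain ⟨c, hc⟩ := hx
      have hlt := ZMod.val_lt x
      -- From 2x = Dc and x < D follows c ∈ {0, 1}, that is, x = 0 or x = D/2.
      have hc2 : c < 2 := by
        by_contra! h
        have := Nat.mul_le_mul_left D h
        omega
      rw [← ZMod.val_eq_zero]
      interval_cases c
      · exact .inl (by omega)
      · right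
        rw [← ZMod.natCast_zmod_val x]
        congr 1
        omega
    · rintro (rfl | rfl)
      · simp
      · rw [nsmul_eq_mul, ← Nat.cast_mul, two_mul, ← hk, ZMod.natCast_self]
  change Nat.card ({x : ZMod D | 2 • x = 0} : Set (ZMod D)) = 2
  rw [Nat.card_coe_set_eq, hset, Set.ncard_pair hk0.symm]

lemma natCard_two_torsion_phaseSpace (D m : ℕ) :
    ({a | 2 • a = 0} : Set (PhaseSpace D m)).ncard =
      (Nat.card {x : ZMod D // 2 • x = 0} ^ 2) ^ m := by
  have e : {a : PhaseSpace D m // 2 • a = 0} ≃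
      (Fin m → {x : ZMod D // 2 • x = 0} × {x : ZMod D // 2 • x = 0}) :=
    { toFun := fun a i => (⟨(a.1 i).1, by simpa using congrArg (fun f => (f i).1) a.2⟩,
        ⟨(a.1 i).2, by simpa using congrArg (fun f => (f i).2) a.2⟩)
      invFun := fun f => ⟨fun i => ((f i).1, (f i).2),
        funext fun i => Prod.ext (f i).1.2 (f i).2.2⟩
      left_inv := fun a => rfl
      right_inv := fun f => rfl }
  rw [← Nat.card_coe_set_eq]
  refine (Nat.card_congr e).trans ?_
  rw [Nat.card_fun, Nat.card_prod, Nat.card_fin, sq]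

/-! ### The entropy gap. -/

theorem theorem2 (d n : ℕ) [NeZero d] (S : AddSubgroup (PhaseSpace d n))
    (hS : IsTotallyIsotropic S) (D m : ℕ) [NeZero D]
    (V : QuditSpace D m →ₗᵢ[ℂ] QuditSpace d n)
    (hV : LinearMap.range V.toLinearMap = stabilizerCodespace S 0) :
    D ^ m * Nat.card S = d ^ n ∧
    ∀ α : ℝ,
      ((Odd (D ^ m) ∧ α = 1) ∨
        (Even D ∧ m = 1 ∧ α = 4) ∨
        (D = 2 ∧ α = ((D : ℝ) ^ m) ^ 2) ∨
        (Even D ∧ α = 4 ^ m)) →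
      aseGap V =
        (α * (d : ℝ) ^ n - ((halfPerpSet S).ncard : ℝ) * (D : ℝ) ^ m) /
          ((d : ℝ) ^ n * ((D : ℝ) ^ m + 1) * ((D : ℝ) ^ m + 2) * ((D : ℝ) ^ m + 3)) := by
  have hfin : Module.finrank ℂ (QuditSpace D m) = D ^ m := by simp [ZMod.card]
  refine ⟨?_, fun α hα => ?_⟩
  · rw [← hfin]
    exact finrank_mul_card hV
  set N : ℝ := (D : ℝ) ^ m with hNdef
  have hN : N = Module.finrank ℂ (QuditSpace D m) := by
    rw [hfin, hNdef, Nat.cast_pow]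
  have hNpos : 0 < N := by
    rw [hN]
    exact_mod_cast Module.finrank_pos
  have hd : (0 : ℝ) < (d : ℝ) ^ n := by
    have := Nat.pos_of_ne_zero (NeZero.ne d)
    positivity
  -- Every listed value of α is the number of two-torsion points of the small phase space: 1 or 4
  -- per qudit as D is odd or even.
  have hα' : α = (halfPerpSet (⊥ : AddSubgroup (PhaseSpace D m))).ncard := by
    have heven : Even D → α = 4 ^ m →
        α = (halfPerpSet (⊥ : AddSubgroup (PhaseSpace D m))).ncard := by
      intro hD h
      rw [h, halfPerpSet_bot, natCard_two_torsion_phaseSpace, ZMod.natCard_two_torsion_even hD]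
      norm_num
    rcases hα with ⟨hodd, h⟩ | ⟨hD, hm, h⟩ | ⟨hD, h⟩ | ⟨hD, h⟩
    -- If m = 0, then D^m = 1 is odd whatever the parity of D; the count is 1 anyway.
    · rcases Nat.eq_zero_or_pos m with rfl | hm
      · rw [h, halfPerpSet_bot, natCard_two_torsion_phaseSpace]
        simp
      · rw [Nat.odd_pow_iff hm.ne'] at hodd
        rw [h, halfPerpSet_bot, natCard_two_torsion_phaseSpace, ZMod.natCard_two_torsion_odd hodd]
        simp
    · exact heven hD (by rw [h, hm, pow_one])
    · refine heven (hD ▸ even_two) ?_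
      rw [h, hNdef, hD, ← pow_mul, mul_comm, pow_mul]
      norm_num
    · exact heven hD h
  have hbig := average_stabilizerEntropy (volume : Measure (QuditSpace D m)) hS hV hN
  -- The same formula with S trivial and V the identity; only its last term differs from that of the
  -- code.
  have hsmall := average_stabilizerEntropy (volume : Measure (QuditSpace D m))
    (S := (⊥ : AddSubgroup (PhaseSpace D m))) (V := LinearIsometry.id)
    (fun a ha b _ => by rw [AddSubgroup.mem_bot.1 ha]; simp [symplecticForm])
    (by rw [stabilizerCodespace_bot]; exact LinearMap.range_id) hN
  rw [← hα'] at hsmall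
  have hgap : aseGap V = (⨍ ψ : Metric.sphere (0 : QuditSpace D m) 1, stabilizerEntropy (V ψ)
      ∂(volume : Measure (QuditSpace D m)).toSphere) -
      ⨍ ψ : Metric.sphere (0 : QuditSpace D m) 1,
        stabilizerEntropy (LinearIsometry.id (R := ℂ) (ψ : QuditSpace D m))
      ∂(volume : Measure (QuditSpace D m)).toSphere := by
    rw [aseGap, average_eq, average_eq, average_eq, ← smul_sub,
      ← integral_sub (integrable_stabilizerEntropy _) (integrable_stabilizerEntropy _)]
    rfl
  rw [hgap, hbig, hsmall, ← hNdef]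
  field_simp
  ring
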